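/- Let $q$ be a prime power and let $k,m,t$ be positive integers with $m+t\le k$. For $1\le b\le a$ let $\binom{a}{b}_q=\frac{(q^a-1)\cdots(q^{a-b+1}-1)}{(q^b-1)\cdots(q-1)}$. **Definitions.** A graph $\mathcal L$ with finite vertex set is a *caching line graph* (with parameters $K,D$) if its vertices are partitioned into $K$ cliques of size $D$ (the *user-cliques*) such that (i) for two distinct user-cliques $\mathcal U,\mathcal U'$, every vertex of $\mathcal U$ has at most one neighbour in $\mathcal U'$; (ii) for every vertex $e$, the set consisting of $e$ and its neighbours outside its own user-clique is a clique (the *subfile-clique* of $e$). It is a *$(c,d)$-caching line graph*, for positive integers $c,d$, if moreover its vertices are covered by pairwise disjoint subfile-cliques of size $c$, and the vertices of $\overline{\mathcal L^2}$, the complement of the square of $\mathcal L$, are covered by pairwise disjoint cliques of size $d$. A (symmetric) *coded caching scheme* for a set of $K$ users and $N$ files, each consisting of $F$ subfiles with values in a finite abelian group $A$, consists of the choice, for every user, of the set of subfile indices it stores (for every file), of a rule that sends, for every vector of demands (one file per user), a number $n$ of transmissions in $A$ depending on the files, and of decoders with which every user always recovers the file it demands from its cache and the transmissions. Its rate is $R=n/F$;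 $MF$ is the number of subfiles in the cache of a user over all $N$ files. **Construction.** Let $\mathcal L$ be the graph whose vertices are the pairs $(V,X)$ of subspaces of $\mathbb F_q^k$ with $\dim V=t$, $\dim X=m+t$, $V\subseteq X$, where distinct $(V,X)$, $(V',X')$ are adjacent if and only if $V=V'$ or $X=X'$; the user-clique of $V$ is the set of all pairs with first entry $V$. A *choice of matching subspaces* assigns to every vertex $(V,X)$ an $m$-dimensional subspace $T_{V,X}$ with $X=T_{V,X}\oplus V$ such that, for every fixed $X$, $V\mapsto T_{V,X}$ is a bijection from the $t$-dimensional to the $m$-dimensional subspaces of $X$. For an $m$-dimensional subspace $T$ put $\mathcal C_T=\{(V,X):T_{V,X}=T\}$. **Theorem.** $\mathcal L$ is a $\left(\binom{m+t}{t}_q,\binom{k-m}{t}_q\right)$-caching line graph, with user-cliques of size $D=\binom{k-t}{m}_q$; its subfile-cliques are the sets of all pairs with a common second entry $X$; and it is the line graph of the bipartite graph in which the $t$-dimensional subspaces $V$ (the users) are joined to the $(m+t)$-dimensional subspaces $X$ (the subfiles) containing them, $(V,X)$ corresponding to the edge $\{V,X\}$. Choices of matching subspaces exist, and for every such choice the sets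 $\mathcal C_T$ are pairwise disjoint cliques of $\overline{\mathcal L^2}$ of size $\binom{k-m}{t}_q$ that cover all vertices. For every finite abelian group $A$ and every number $N\ge1$ of files, the following is a coded caching scheme (suitable decoders exist): user $V$ stores the subfile $X$ of every file if and only if $V\not\subseteq X$; if user $V$ demands file $d_V$, there is one transmission $\sum_{(V,X)\in\mathcal C_T}W_{d_V,X}$ for each set $\mathcal C_T$, where $W_{i,X}$ is the subfile $X$ of file $i$. It has $$K=\binom{k}{t}_q,\qquad F=\binom{k}{m+t}_q,\qquad \frac MN=1-\frac{\binom{m+t}{t}_q}{\binom{k}{t}_q},\qquad R=\frac{\binom{m+t}{t}_q}{\binom{k-m}{t}_q}.$$ -/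

import Mathlib

open scoped BigOperators

noncomputable section

namespace CodedCaching

/-- The square of a graph: distinct vertices are joined when they are adjacent or have a common
neighbour. -/
def square {W : Type*} (G : SimpleGraph W) : SimpleGraph W where
  Adj u v := u ≠ v ∧ (G.Adj u v ∨ ∃ w, G.Adj u w ∧ G.Adj w v)
  symm := ⟨by
    rintro u v ⟨hne, h | ⟨w, huw, hwv⟩⟩
    · exact ⟨hne.symm, Or.inl h.symm⟩
    · exact ⟨hne.symm, Or.inr ⟨w, hwv.symm, huw.symm⟩⟩⟩
  loopless := ⟨fun _ h => h.1 rfl⟩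

/-- A clique cover of `G` by pairwise disjoint cliques, each of which has `b` vertices. -/
structure IsDisjointCliqueCover {W : Type*} (G : SimpleGraph W) (𝒞 : Set (Set W)) (b : ℕ) :
    Prop where
  isClique : ∀ C ∈ 𝒞, G.IsClique C
  card_eq : ∀ C ∈ 𝒞, C.ncard = b
  disjoint : 𝒞.PairwiseDisjoint id
  cover : ⋃₀ 𝒞 = Set.univ

/-- The subfile-clique of a vertex `e`: `e` together with its neighbours outside the user-clique
of `e`. The user-cliques are the fibres of `user`. -/
def subfileClique {W U : Type*} (L : SimpleGraph W) (user : W → U) (e : W) : Set W :=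
  insert e {f | L.Adj e f ∧ user f ≠ user e}

/-- `L` is a caching line graph whose user-cliques are the fibres of `user : W → U`, which have
`D` vertices each. The number of user-cliques is the number of elements of `U`. -/
structure IsCachingLineGraph {W U : Type*} (L : SimpleGraph W) (user : W → U) (D : ℕ) :
    Prop where
  finite_vertices : Finite W
  finite_users : Finite U
  userClique_isClique : ∀ u : U, L.IsClique {e | user e = u}
  userClique_card : ∀ u : U, {e : W | user e = u}.ncard = D
  at_most_one : ∀ e f g : W, user f = user g → user f ≠ user e → L.Adj e f → L.Adj e g → f = g
  subfileClique_isClique : ∀ e : W, L.IsClique (subfileClique L user e)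

/-- `L`, with user-cliques the fibres of `user`, each of `D` vertices, is a `(c, d)`-caching line
graph. -/
structure IsCDCachingLineGraph {W U : Type*} (L : SimpleGraph W) (user : W → U) (D c d : ℕ) :
    Prop where
  isCachingLineGraph : IsCachingLineGraph L user D
  c_pos : 0 < c
  d_pos : 0 < d
  subfile_cover : ∃ 𝒮 : Set (Set W), (∀ S ∈ 𝒮, ∃ e, S = subfileClique L user e) ∧
    IsDisjointCliqueCover L 𝒮 c
  transmission_cover : ∃ 𝒟 : Set (Set W), IsDisjointCliqueCover (square L)ᶜ 𝒟 d

/-- The bipartite graph of a symmetric caching scheme: user `u` and subfile `f` are joined exactly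
when `u` does not cache `f`. -/
def uncachedGraph {U F : Type*} (cached : U → Set F) : SimpleGraph (U ⊕ F) :=
  SimpleGraph.fromRel fun x y => ∃ u f, x = Sum.inl u ∧ y = Sum.inr f ∧ f ∉ cached u

/-- A coded caching scheme with symmetric caching for `N` files. The users are the elements of
`U`, every file consists of subfiles indexed by `F` with values in `A`, and for each demand vector
the server broadcasts one element of `A` for every element of `T`. From the broadcast and from its
own cache, every user recovers all subfiles of the file it demands. -/
structure Scheme (A U F T : Type*) (N : ℕ) where
  /-- the subfiles (of every file) that a user stores -/
  cached : U → Set F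
  /-- the broadcast, for given demands and files -/
  transmit : (U → Fin N) → (Fin N → F → A) → T → A
  /-- the decoder of a user, for given demands, cache content and broadcast -/
  decode : (u : U) → (U → Fin N) → (Fin N → cached u → A) → (T → A) → F → A
  decode_eq : ∀ (dem : U → Fin N) (file : Fin N → F → A) (u : U),
    decode u dem (fun i f => file i f) (transmit dem file) = file (dem u)

namespace Scheme

variable {A U F T : Type*} {N : ℕ}

/-- The number of users. -/
def numUsers (_S : Scheme A U F T N) : ℕ := Nat.card U

/-- The subpacketization: the number of subfiles of a file. -/
def subpacketization (_S : Scheme A U F T N) : ℕ := Nat.card F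

/-- Every user stores `M` times the number of subfiles of a file, over all the `N` files. -/
def HasCacheSize (S : Scheme A U F T N) (M : ℚ) : Prop :=
  ∀ u : U, ({p | p.2 ∈ S.cached u} : Set (Fin N × F)).ncard = M * S.subpacketization

/-- The rate: the number of transmissions over the number of subfiles of a file. -/
def rate (S : Scheme A U F T N) : ℚ := Nat.card T / S.subpacketization

end Scheme

/-- The transmission of a clique `C`: the sum, over its vertices `e`, of the subfile of `e` in the
file demanded by the user of `e`. -/
def cliqueTransmission {A W U F : Type*} [AddCommGroup A] {N : ℕ} (user : W → U) (subfile : W → F)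
    (C : Set W) (dem : U → Fin N) (file : Fin N → F → A) : A :=
  ∑ᶠ e ∈ C, file (dem (user e)) (subfile e)

/-- The Gaussian binomial coefficient
`(q^a - 1) ⋯ (q^(a-b+1) - 1) / ((q^b - 1) ⋯ (q - 1))`, for `b ≤ a`. -/
def gaussBinom (q a b : ℕ) : ℚ :=
  (∏ i ∈ Finset.range b, ((q : ℚ) ^ (a - i) - 1)) / ∏ i ∈ Finset.range b, ((q : ℚ) ^ (b - i) - 1)

/-- The `r`-dimensional subspaces of `𝔽^k`. -/
abbrev Subspaces (𝔽 : Type*) [Field 𝔽] (k r : ℕ) : Type _ :=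
  {V : Submodule 𝔽 (Fin k → 𝔽) // Module.finrank 𝔽 V = r}

/-- The pairs `(V, X)` of a `t`-dimensional subspace `V` and an `(m + t)`-dimensional subspace
`X` that contains it. -/
abbrev ProjVertex (𝔽 : Type*) [Field 𝔽] (k m t : ℕ) : Type _ :=
  {p : Subspaces 𝔽 k t × Subspaces 𝔽 k (m + t) // p.1.1 ≤ p.2.1}

variable {𝔽 : Type*} [Field 𝔽] {k m t : ℕ}

/-- The user `V` of the vertex `(V, X)`. -/
def ProjVertex.user (p : ProjVertex 𝔽 k m t) : Subspaces 𝔽 k t := p.1.1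

/-- The subfile `X` of the vertex `(V, X)`. -/
def ProjVertex.subfile (p : ProjVertex 𝔽 k m t) : Subspaces 𝔽 k (m + t) := p.1.2

variable (𝔽 k m t) in
/-- The graph on the pairs `(V, X)` in which all pairs with the same `V` form a clique, all pairs
with the same `X` form a clique, and there are no other edges. -/
def projGraph : SimpleGraph (ProjVertex 𝔽 k m t) where
  Adj p p' := p ≠ p' ∧ (p.user = p'.user ∨ p.subfile = p'.subfile)
  symm := ⟨fun _ _ h => ⟨h.1.symm, h.2.imp Eq.symm Eq.symm⟩⟩
  loopless := ⟨fun _ h => h.1 rfl⟩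

variable (𝔽 k m t) in
/-- The caching rule: user `V` stores the subfile `X` (of every file) unless `V ⊆ X`. -/
def projCached (V : Subspaces 𝔽 k t) : Set (Subspaces 𝔽 k (m + t)) := {X | ¬ V.1 ≤ X.1}

/-- `τ` assigns matching subspaces: `τ (V, X)` is an `m`-dimensional subspace with
`X = τ (V, X) ⊕ V`, and for fixed `X` the map `V ↦ τ (V, X)` is a bijection from the
`t`-dimensional to the `m`-dimensional subspaces of `X`. -/
structure IsMatchingLabel (τ : ProjVertex 𝔽 k m t → Subspaces 𝔽 k m) : Prop where
  sup_eq : ∀ p, (τ p).1 ⊔ p.user.1 = p.subfile.1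
  inf_eq : ∀ p, (τ p).1 ⊓ p.user.1 = ⊥
  bijective : ∀ (X : Subspaces 𝔽 k (m + t)) (T : Subspaces 𝔽 k m), T.1 ≤ X.1 →
    ∃! p : ProjVertex 𝔽 k m t, p.subfile = X ∧ τ p = T

/-- The sets `C_T` of all vertices with matching subspace `T`, for all `m`-dimensional `T`. -/
def labelCliques (τ : ProjVertex 𝔽 k m t → Subspaces 𝔽 k m) : Set (Set (ProjVertex 𝔽 k m t)) :=
  Set.range fun T : Subspaces 𝔽 k m => {p | τ p = T}

end CodedCaching

end

noncomputable section

namespace CodedCaching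

/-! Everything rests on one geometric fact and on double counting. Suppose (V, X) and (V', X') have
the same label T and V ⊆ X'. Then X = T + V ⊆ X', so X = X' by dimension, and V = V' because labels
are injective for fixed X (`IsMatchingLabel.eq_of_user_le`). Vertices at distance at most 2 in the
graph satisfy V ⊆ X' or V' ⊆ X, so distinct vertices of C_T are neither adjacent nor joined by a
path of length 2. The same fact gives decoding: a user that needs one summand of a transmission has
all the others in its cache and can subtract them.

Matching subspaces exist because, inside a fixed X, complementarity between t- and m-dimensional
subspaces is a regular relation of degree q^(mt) on both sides (`card_isCompl`), so that Hall's
theorem yields a perfect matching (`exists_bijective_of_regular`).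

For the parameters, the vertices are counted by V, by X and by T: K·D = F·c = n·d, where n is the
number of labels T. The first equality gives M/N, the second the rate. -/

theorem card_eq_card_mul_of_fiber {W U : Type*} [Finite W] [Finite U] (f : W → U) {D : ℕ}
    (h : ∀ u, {e | f e = u}.ncard = D) : Nat.card W = Nat.card U * D := by
  have := Fintype.ofFinite U
  rw [← Nat.card_congr (Equiv.sigmaFiberEquiv f), Nat.card_sigma,
    Finset.sum_congr rfl fun u _ => (show Nat.card {e // f e = u} = D from h u)]
  simp

/-! ### Counting subspaces and complements; matchings from regularity. -/

section LinearAlgebra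

variable {𝔽 E : Type*} [Field 𝔽] [AddCommGroup E] [Module 𝔽 E]

/-- An independent r-tuple lies in exactly one r-dimensional subspace, its span. -/
theorem card_linearIndependent_eq_sigma [Finite E] (r : ℕ) :
    Nat.card {s : Fin r → E // LinearIndependent 𝔽 s} =
      Nat.card (Σ V : {V : Submodule 𝔽 E // Module.finrank 𝔽 V = r},
        {s : Fin r → V.1 // LinearIndependent 𝔽 s}) := by
  have hspan : ∀ (V : Submodule 𝔽 E) (_ : Module.finrank 𝔽 V = r) (s : Fin r → V),
      LinearIndependent 𝔽 s → Submodule.span 𝔽 (Set.range fun i => (s i : E)) = V := by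
    intro V hV s hs
    have h := congrArg (Submodule.map V.subtype)
      (hs.span_eq_top_of_card_eq_finrank' (by simpa using hV.symm))
    rwa [Submodule.map_span, ← Set.range_comp, Submodule.map_top, Submodule.range_subtype] at h
  refine (Nat.card_eq_of_bijective (fun s => ⟨fun i => s.2.1 i,
    s.2.2.map' s.1.1.subtype (Submodule.ker_subtype _)⟩) ⟨?_, fun s => ?_⟩).symm
  · rintro ⟨⟨V, hV⟩, s, hs⟩ ⟨⟨V', hV'⟩, s', hs'⟩ h
    have h : (fun i => (s i : E)) = fun i => (s' i : E) := congrArg Subtype.val h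
    obtain rfl : V = V' := by rw [← hspan V hV s hs, ← hspan V' hV' s' hs', h]
    obtain rfl : s = s' := funext fun i => Subtype.ext (congrFun h i)
    rfl
  · exact ⟨⟨⟨Submodule.span 𝔽 (Set.range s.1), by simpa using finrank_span_eq_card s.2⟩,
      fun i => ⟨s.1 i, Submodule.subset_span ⟨i, rfl⟩⟩, linearIndependent_span s.2⟩, rfl⟩

/-- Factoring q^i out of the i-th factor on both sides leaves the defining quotient. This product
form is the one that counting independent tuples produces. -/
theorem gaussBinom_mul_prod (q n r : ℕ) (hq : 1 < q) (hr : r ≤ n) :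
    gaussBinom q n r * ∏ i : Fin r, ((q : ℚ) ^ r - q ^ (i : ℕ)) =
      ∏ i : Fin r, ((q : ℚ) ^ n - q ^ (i : ℕ)) := by
  have hsplit : ∀ a, r ≤ a → ∏ i : Fin r, ((q : ℚ) ^ a - q ^ (i : ℕ)) =
      (∏ i ∈ Finset.range r, (q : ℚ) ^ i) * ∏ i ∈ Finset.range r, ((q : ℚ) ^ (a - i) - 1) := by
    intro a ha
    rw [Fin.prod_univ_eq_prod_range (fun i => (q : ℚ) ^ a - q ^ i), ← Finset.prod_mul_distrib]
    refine Finset.prod_congr rfl fun i hi => ?_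
    rw [mul_sub, ← pow_add, mul_one,
      Nat.add_sub_of_le ((Finset.mem_range.1 hi).le.trans ha)]
  have hne : ∏ i ∈ Finset.range r, ((q : ℚ) ^ (r - i) - 1) ≠ 0 := by
    refine Finset.prod_ne_zero_iff.2 fun i hi => sub_ne_zero.2 (ne_of_gt ?_)
    exact one_lt_pow₀ (by exact_mod_cast hq) (Nat.sub_ne_zero_of_lt (Finset.mem_range.1 hi))
  rw [hsplit r le_rfl, hsplit n hr, gaussBinom]
  field_simp

theorem gaussBinom_pos {q n r : ℕ} (hq : 1 < q) (hr : r ≤ n) : 0 < gaussBinom q n r := by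
  have h : ∀ a, r ≤ a → 0 < ∏ i ∈ Finset.range r, ((q : ℚ) ^ (a - i) - 1) := fun a ha =>
    Finset.prod_pos fun i hi => sub_pos.2 (one_lt_pow₀ (by exact_mod_cast hq)
      (Nat.sub_ne_zero_of_lt ((Finset.mem_range.1 hi).trans_le ha)))
  exact div_pos (h n hr) (h r le_rfl)

/-- Independent r-tuples of E are counted directly and by their span; each r-dimensional span
contributes the same number of tuples. -/
theorem card_finrank_eq [Fintype 𝔽] [Finite E] {r : ℕ} (hr : r ≤ Module.finrank 𝔽 E) :
    (Nat.card {V : Submodule 𝔽 E // Module.finrank 𝔽 V = r} : ℚ) =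
      gaussBinom (Fintype.card 𝔽) (Module.finrank 𝔽 E) r := by
  have hq : 1 < Fintype.card 𝔽 := Fintype.one_lt_card
  have := Fintype.ofFinite {V : Submodule 𝔽 E // Module.finrank 𝔽 V = r}
  have hcast : ∀ a, r ≤ a → ((∏ i : Fin r, (Fintype.card 𝔽 ^ a - Fintype.card 𝔽 ^ (i : ℕ)) : ℕ) : ℚ)
      = ∏ i : Fin r, ((Fintype.card 𝔽 : ℚ) ^ a - (Fintype.card 𝔽 : ℚ) ^ (i : ℕ)) := by
    intro a ha
    rw [Nat.cast_prod]
    refine Finset.prod_congr rfl fun i _ => ?_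
    rw [Nat.cast_sub (Nat.pow_le_pow_right hq.le (i.2.le.trans ha)), Nat.cast_pow, Nat.cast_pow]
  have h := card_linearIndependent_eq_sigma (𝔽 := 𝔽) (E := E) r
  rw [card_linearIndependent hr, Nat.card_sigma] at h
  have hV : ∀ V : {V : Submodule 𝔽 E // Module.finrank 𝔽 V = r},
      Nat.card {s : Fin r → V.1 // LinearIndependent 𝔽 s} =
        ∏ i : Fin r, (Fintype.card 𝔽 ^ r - Fintype.card 𝔽 ^ (i : ℕ)) := fun V => by
    rw [card_linearIndependent V.2.ge, V.2]
  rw [Finset.sum_congr rfl fun V _ => hV V, Finset.sum_const, smul_eq_mul, Finset.card_univ,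
    ← Nat.card_eq_fintype_card (α := {V : Submodule 𝔽 E // _})] at h
  have h' := congrArg (Nat.cast : ℕ → ℚ) h
  rw [Nat.cast_mul, hcast _ hr, hcast _ le_rfl, ← gaussBinom_mul_prod _ _ _ hq hr] at h'
  refine (mul_right_cancel₀ ?_ h').symm
  refine Finset.prod_ne_zero_iff.2 fun i _ => sub_ne_zero.2 (ne_of_gt ?_)
  exact pow_lt_pow_right₀ (by exact_mod_cast hq) i.2

theorem card_le_finrank_eq [Fintype 𝔽] [Finite E] (X : Submodule 𝔽 E) {r : ℕ}
    (hr : r ≤ Module.finrank 𝔽 X) :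
    (Nat.card {V : Submodule 𝔽 E // V ≤ X ∧ Module.finrank 𝔽 V = r} : ℚ) =
      gaussBinom (Fintype.card 𝔽) (Module.finrank 𝔽 X) r := by
  rw [← card_finrank_eq hr]
  congr 1
  refine (Nat.card_congr ?_).symm
  have e := X.mapIic.toEquiv.subtypeEquiv (p := fun V : Submodule 𝔽 X => Module.finrank 𝔽 V = r)
    (q := fun V : Set.Iic X => Module.finrank 𝔽 V.1 = r) fun V => iff_of_eq
      (congrArg (· = r) (Submodule.finrank_map_subtype_eq X V).symm)
  exact e.trans (Equiv.subtypeSubtypeEquivSubtypeInter (· ≤ X) fun V => Module.finrank 𝔽 V = r)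

theorem finrank_map_mkQ_add [FiniteDimensional 𝔽 E] {T X : Submodule 𝔽 E} (h : T ≤ X) :
    Module.finrank 𝔽 (X.map T.mkQ) + Module.finrank 𝔽 T = Module.finrank 𝔽 X := by
  rw [← LinearMap.finrank_range_add_finrank_ker (T.mkQ.domRestrict X), LinearMap.range_domRestrict,
    LinearMap.ker_domRestrict, Submodule.ker_mkQ,
    (Submodule.comapSubtypeEquivOfLe h).finrank_eq]

/-- Subspaces containing T correspond to subspaces of E / T, with the dimension lowered by that of
T. -/
theorem card_ge_finrank_eq [Fintype 𝔽] [Finite E] (T : Submodule 𝔽 E) {r s n : ℕ}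
    (hs : Module.finrank 𝔽 T + r = s) (hn : Module.finrank 𝔽 E = n) (hsn : s ≤ n) :
    (Nat.card {X : Submodule 𝔽 E // T ≤ X ∧ Module.finrank 𝔽 X = s} : ℚ) =
      gaussBinom (Fintype.card 𝔽) (n - Module.finrank 𝔽 T) r := by
  have : Finite (E ⧸ T) := Quotient.finite _
  have hQ := T.finrank_quotient_add_finrank
  have : Module.finrank 𝔽 (E ⧸ T) = n - Module.finrank 𝔽 T := by omega
  rw [← this, ← card_finrank_eq (by omega)]
  congr 1
  refine Nat.card_congr ((Equiv.subtypeSubtypeEquivSubtypeInter (T ≤ ·)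
    fun V => Module.finrank 𝔽 V = s).symm.trans ?_)
  refine (Submodule.comapMkQRelIso T).symm.toEquiv.subtypeEquiv fun X => ?_
  have h := finrank_map_mkQ_add X.2
  change _ ↔ Module.finrank 𝔽 (X.1.map T.mkQ) = r
  omega

/-- Complements of V are the kernels of projections onto V. Such a projection is determined by its
restriction to one fixed complement W, which can be any linear map W → V. -/
theorem card_isCompl [Fintype 𝔽] [Finite E] (V : Submodule 𝔽 E) :
    Nat.card {T : Submodule 𝔽 E // IsCompl V T} =
      Fintype.card 𝔽 ^ ((Module.finrank 𝔽 E - Module.finrank 𝔽 V) * Module.finrank 𝔽 V) := by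
  obtain ⟨W, hW⟩ := V.exists_isCompl
  have hfin := Submodule.finrank_add_eq_of_isCompl hW
  have e : {f : E →ₗ[𝔽] V // ∀ x : V, f x = x} ≃ (W →ₗ[𝔽] V) :=
    { toFun f := f.1.domRestrict W
      invFun g := ⟨LinearMap.ofIsCompl hW LinearMap.id g, fun x => by simp⟩
      left_inv f := Subtype.ext (LinearMap.ofIsCompl_eq hW (fun u => (f.2 u).symm) fun _ => rfl)
      right_inv g := by ext x; simp }
  have : Finite (W →ₗ[𝔽] V) := Module.finite_of_finite 𝔽
  rw [Nat.card_congr (V.isComplEquivProj.trans e), Module.natCard_eq_pow_finrank (K := 𝔽),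
    Nat.card_eq_fintype_card, Module.finrank_linearMap]
  congr 2
  omega

/-- A regular relation between finite types contains a bijection. -/
theorem exists_bijective_of_regular {α β : Type*} [Finite α] [Finite β] (r : α → β → Prop)
    {d : ℕ} (hd : 0 < d) (hα : ∀ a, Nat.card {b // r a b} = d)
    (hβ : ∀ b, Nat.card {a // r a b} = d) :
    ∃ f : α → β, Function.Bijective f ∧ ∀ a, r a (f a) := by
  classical
  have := Fintype.ofFinite α
  have := Fintype.ofFinite β
  have hα' : ∀ a, (Finset.univ.bipartiteAbove r a).card = d := fun a => by
    rw [← hα a, Nat.card_eq_fintype_card, Fintype.card_subtype]; rfl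
  have hβ' : ∀ b, (Finset.univ.bipartiteBelow r b).card = d := fun b => by
    rw [← hβ b, Nat.card_eq_fintype_card, Fintype.card_subtype]; rfl
  -- Hall's condition: the d·|A| edges leaving A all end in its neighbourhood, each point of which
  -- absorbs at most d of them.
  obtain ⟨f, hf, hr⟩ := (Fintype.all_card_le_filter_rel_iff_exists_injective r).1 fun A => by
    refine Nat.le_of_mul_le_mul_right (Finset.card_mul_le_card_mul r (fun a ha => ?_)
      fun b _ => ?_) hd
    · rw [← hα' a]
      exact Finset.card_le_card fun b hb => by
        simp only [Finset.mem_bipartiteAbove, Finset.mem_univ, true_and, Finset.mem_filter] at hb ⊢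
        exact ⟨⟨a, ha, hb⟩, hb⟩
    · rw [← hβ' b]
      exact Finset.card_le_card (Finset.filter_subset_filter _ (Finset.subset_univ _))
  refine ⟨f, (Fintype.bijective_iff_injective_and_card f).2 ⟨hf, ?_⟩, hr⟩
  exact Nat.eq_of_mul_eq_mul_right hd
    (Finset.card_mul_eq_card_mul r (fun a _ => hα' a) fun b _ => hβ' b)

/-- A complement of a t-dimensional subspace automatically has dimension m, and vice versa, so
`card_isCompl` gives degree q^(mt) on both sides. -/
theorem exists_bijective_isCompl [Fintype 𝔽] [Finite E] {m t : ℕ}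
    (h : Module.finrank 𝔽 E = m + t) :
    ∃ f : {V : Submodule 𝔽 E // Module.finrank 𝔽 V = t} →
        {T : Submodule 𝔽 E // Module.finrank 𝔽 T = m},
      Function.Bijective f ∧ ∀ V, IsCompl V.1 (f V).1 := by
  have := Module.finite_of_finite 𝔽 (M := E)
  refine exists_bijective_of_regular (α := {V : Submodule 𝔽 E // Module.finrank 𝔽 V = t})
    (β := {T : Submodule 𝔽 E // Module.finrank 𝔽 T = m}) (fun V T => IsCompl V.1 T.1) (d := Fintype.card 𝔽 ^ (m * t))
    (pow_pos Fintype.card_pos _) (fun V => ?_) fun T => ?_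
  · have hV := card_isCompl V.1
    rw [h, V.2, Nat.add_sub_cancel] at hV
    rw [← hV]
    refine Nat.card_congr (Equiv.subtypeSubtypeEquivSubtype fun {T} hT => ?_)
    have := Submodule.finrank_add_eq_of_isCompl hT
    have := V.2
    omega
  · have hT := card_isCompl T.1
    rw [h, T.2, Nat.add_sub_cancel_left, mul_comm] at hT
    rw [← hT]
    refine Nat.card_congr ((Equiv.subtypeEquivRight fun V => isCompl_comm).trans
      (Equiv.subtypeSubtypeEquivSubtype fun {V} hV => ?_))
    have := Submodule.finrank_add_eq_of_isCompl hV
    have := T.2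
    omega

end LinearAlgebra

/-! ### The graph on pairs (V, X) as a line graph. -/

variable {𝔽 : Type*} [Field 𝔽] {k m t : ℕ}

theorem projVertex_ext {p p' : ProjVertex 𝔽 k m t} (h₁ : p.user = p'.user)
    (h₂ : p.subfile = p'.subfile) : p = p' :=
  Subtype.ext (Prod.ext h₁ h₂)

theorem subfileClique_projGraph (p : ProjVertex 𝔽 k m t) :
    subfileClique (projGraph 𝔽 k m t) ProjVertex.user p = {p' | p'.subfile = p.subfile} := by
  ext p'
  simp only [subfileClique, projGraph, Set.mem_insert_iff, Set.mem_ofPred_eq]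
  constructor
  · rintro (rfl | ⟨⟨-, h | h⟩, hu⟩)
    · rfl
    · exact absurd h.symm hu
    · exact h.symm
  · intro h
    by_cases hp : p' = p
    · exact Or.inl hp
    · exact Or.inr ⟨⟨Ne.symm hp, Or.inr h.symm⟩, fun hu => hp (projVertex_ext hu h)⟩

theorem uncachedGraph_adj_inl_inr {V : Subspaces 𝔽 k t} {X : Subspaces 𝔽 k (m + t)} :
    (uncachedGraph (projCached 𝔽 k m t)).Adj (Sum.inl V) (Sum.inr X) ↔ V.1 ≤ X.1 := by
  constructor
  · rintro ⟨-, ⟨V', X', hV, hX, h⟩ | ⟨V', X', hV, hX, h⟩⟩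
    · cases hV
      cases hX
      exact not_not.1 h
    · cases hV
  · exact fun h => ⟨Sum.inl_ne_inr, Or.inl ⟨V, X, rfl, rfl, not_not.2 h⟩⟩

variable (𝔽 k m t) in
/-- The vertex `(V, X)` as the edge joining `V` to `X`. -/
def projEdge (p : ProjVertex 𝔽 k m t) : (uncachedGraph (projCached 𝔽 k m t)).edgeSet :=
  ⟨s(Sum.inl p.user, Sum.inr p.subfile), uncachedGraph_adj_inl_inr.2 p.2⟩

theorem projEdge_bijective : Function.Bijective (projEdge 𝔽 k m t) := by
  constructor
  · intro p p' h
    have h : s(Sum.inl p.user, Sum.inr p.subfile) = s(Sum.inl p'.user, Sum.inr p'.subfile) :=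
      congrArg Subtype.val h
    simp only [Sym2.eq_iff, Sum.inl.injEq, Sum.inr.injEq, reduceCtorEq, and_self, or_false] at h
    exact projVertex_ext h.1 h.2
  · rintro ⟨e, he⟩
    induction e with | _ x y =>
    -- `fromRel` symmetrizes the relation, so the endpoints of an edge may come in either order.
    obtain ⟨-, ⟨V, X, hx, hy, h⟩ | ⟨V, X, hx, hy, h⟩⟩ := id he
    · obtain rfl : x = Sum.inl V := hx
      obtain rfl : y = Sum.inr X := hy
      exact ⟨⟨(V, X), not_not.1 h⟩, rfl⟩
    · obtain rfl : y = Sum.inl V := hx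
      obtain rfl : x = Sum.inr X := hy
      exact ⟨⟨(V, X), not_not.1 h⟩, Subtype.ext Sym2.eq_swap⟩

variable (𝔽 k m t) in
/-- The graph `projGraph` is the line graph of the bipartite graph of the caching rule. -/
def projGraphIso : projGraph 𝔽 k m t ≃g (uncachedGraph (projCached 𝔽 k m t)).lineGraph where
  toEquiv := Equiv.ofBijective _ projEdge_bijective
  map_rel_iff' {p p'} := by
    rw [SimpleGraph.lineGraph_adj_iff_exists]
    simp only [Equiv.ofBijective_apply, ne_eq, projEdge_bijective.injective.eq_iff]
    refine and_congr_right fun _ => ?_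
    simp [projEdge, eq_comm]

/-! ### Sizes of user-cliques and subfile-cliques. -/

section Counting

variable [Fintype 𝔽]

theorem card_subspaces {r : ℕ} (hr : r ≤ k) :
    (Nat.card (Subspaces 𝔽 k r) : ℚ) = gaussBinom (Fintype.card 𝔽) k r := by
  rw [card_finrank_eq (by simpa using hr), Module.finrank_fin_fun]

theorem card_user_fiber (hk : m + t ≤ k) (V : Subspaces 𝔽 k t) :
    {p : ProjVertex 𝔽 k m t | p.user = V}.ncard = Nat.card (Subspaces 𝔽 (k - t) m) := by
  have h := card_ge_finrank_eq V.1 (r := m) (s := m + t) (n := k) (by rw [V.2, add_comm])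
    (Module.finrank_fin_fun 𝔽) hk
  rw [V.2, ← card_subspaces (by omega), Nat.cast_inj] at h
  rw [← h, ← Nat.card_coe_set_eq]
  refine Nat.card_congr ⟨fun p => ⟨p.1.subfile.1, ?_, p.1.subfile.2⟩,
    fun X => ⟨⟨(V, ⟨X.1, X.2.2⟩), X.2.1⟩, rfl⟩, ?_, fun X => rfl⟩
  · obtain ⟨p, rfl⟩ := p
    exact p.2
  · rintro ⟨p, rfl⟩
    rfl

theorem card_subfile_fiber (X : Subspaces 𝔽 k (m + t)) :
    {p : ProjVertex 𝔽 k m t | p.subfile = X}.ncard = Nat.card (Subspaces 𝔽 (m + t) t) := by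
  have h := card_le_finrank_eq X.1 (r := t) (by rw [X.2]; omega)
  rw [X.2, ← card_subspaces (by omega), Nat.cast_inj] at h
  rw [← h, ← Nat.card_coe_set_eq]
  refine Nat.card_congr ⟨fun p => ⟨p.1.user.1, ?_, p.1.user.2⟩,
    fun V => ⟨⟨(⟨V.1, V.2.2⟩, X), V.2.1⟩, rfl⟩, ?_, fun V => rfl⟩
  · obtain ⟨p, rfl⟩ := p
    exact p.2
  · rintro ⟨p, rfl⟩
    rfl

end Counting

/-! ### Existence of matching subspaces. -/

variable (𝔽 k m t) in
theorem exists_isMatchingLabel [Finite 𝔽] :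
    ∃ τ : ProjVertex 𝔽 k m t → Subspaces 𝔽 k m, IsMatchingLabel τ := by
  have := Fintype.ofFinite 𝔽
  -- The condition on labels only compares vertices with the same X, so the matchings inside the
  -- various X are chosen independently and then carried to the ambient space.
  choose f hf hc using fun X : Subspaces 𝔽 k (m + t) =>
    exists_bijective_isCompl (𝔽 := 𝔽) (E := X.1) X.2
  have hcomap : ∀ p : ProjVertex 𝔽 k m t,
      Module.finrank 𝔽 (p.user.1.comap p.subfile.1.subtype) = t := fun p =>
    (Submodule.comapSubtypeEquivOfLe p.2).finrank_eq.trans p.user.2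
  have hmap : ∀ p : ProjVertex 𝔽 k m t,
      (p.user.1.comap p.subfile.1.subtype).map p.subfile.1.subtype = p.user.1 := fun p => by
    rw [Submodule.map_comap_subtype, inf_eq_right]
    exact p.2
  refine ⟨fun p => ⟨(f p.subfile ⟨_, hcomap p⟩).1.map p.subfile.1.subtype,
    (Submodule.finrank_map_subtype_eq _ _).trans (f p.subfile ⟨_, hcomap p⟩).2⟩,
    fun p => ?_, fun p => ?_, fun X T hT => ?_⟩
  · have h := congrArg (Submodule.map p.subfile.1.subtype)
      (hc p.subfile ⟨_, hcomap p⟩).symm.sup_eq_top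
    rwa [Submodule.map_sup, hmap, Submodule.map_top, Submodule.range_subtype] at h
  · have h := congrArg (Submodule.map p.subfile.1.subtype)
      (hc p.subfile ⟨_, hcomap p⟩).symm.inf_eq_bot
    rwa [Submodule.map_inf _ (Submodule.injective_subtype _), hmap, Submodule.map_bot] at h
  · have hTc : Module.finrank 𝔽 (T.1.comap X.1.subtype) = m :=
      (Submodule.comapSubtypeEquivOfLe hT).finrank_eq.trans T.2
    obtain ⟨V, hV⟩ := (hf X).surjective ⟨_, hTc⟩
    refine ⟨⟨(⟨V.1.map X.1.subtype, (Submodule.finrank_map_subtype_eq _ _).trans V.2⟩, X),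
      Submodule.map_subtype_le _ _⟩, ⟨rfl, Subtype.ext ?_⟩, ?_⟩
    · have hV' : (⟨_, hcomap ⟨(⟨V.1.map X.1.subtype,
          (Submodule.finrank_map_subtype_eq _ _).trans V.2⟩, X),
          Submodule.map_subtype_le _ _⟩⟩ : {V : Submodule 𝔽 X.1 // Module.finrank 𝔽 V = t}) = V :=
        Subtype.ext (Submodule.comap_map_eq_of_injective (Submodule.injective_subtype _) _)
      refine (congrArg (fun S => (f X S).1.map X.1.subtype) hV').trans ?_
      rw [hV, Submodule.map_comap_subtype, inf_eq_right]
      exact hT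
    · rintro p ⟨rfl, hp⟩
      refine projVertex_ext (Subtype.ext ?_) rfl
      rw [← hmap p]
      refine congrArg (Submodule.map p.subfile.1.subtype) ?_
      have h := congrArg (fun T : Subspaces 𝔽 k m => T.1.comap p.subfile.1.subtype) hp
      have hV' : (⟨_, hcomap p⟩ :
          {V : Submodule 𝔽 p.subfile.1 // Module.finrank 𝔽 V = t}) = V :=
        (hf p.subfile).injective ((Subtype.ext
          ((Submodule.comap_map_eq_of_injective (Submodule.injective_subtype _) _).symm.trans
            h)).trans hV.symm)
      exact congrArg Subtype.val hV'

/-! ### Vertices with a common label. -/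

namespace IsMatchingLabel

variable {τ : ProjVertex 𝔽 k m t → Subspaces 𝔽 k m} (hτ : IsMatchingLabel τ)

theorem le_subfile (hτ : IsMatchingLabel τ) (p : ProjVertex 𝔽 k m t) : (τ p).1 ≤ p.subfile.1 :=
  le_sup_left.trans (hτ.sup_eq p).le

theorem eq_of_subfile_eq (hτ : IsMatchingLabel τ) {p p' : ProjVertex 𝔽 k m t} (h : τ p = τ p')
    (hs : p.subfile = p'.subfile) : p = p' :=
  (hτ.bijective p'.subfile (τ p') (hτ.le_subfile p')).unique ⟨hs, h⟩ ⟨rfl, rfl⟩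

/-- A user needs at most one of the subfiles that occur in a transmission. -/
theorem eq_of_user_le (hτ : IsMatchingLabel τ) {p p' : ProjVertex 𝔽 k m t} (h : τ p = τ p')
    (hle : p.user.1 ≤ p'.subfile.1) : p = p' := by
  refine hτ.eq_of_subfile_eq h (Subtype.ext (Submodule.eq_of_le_of_finrank_eq ?_
    (p.subfile.2.trans p'.subfile.2.symm)))
  rw [← hτ.sup_eq p, h]
  exact sup_le (hτ.le_subfile p') hle

theorem isClique (hτ : IsMatchingLabel τ) (T : Subspaces 𝔽 k m) :
    (square (projGraph 𝔽 k m t))ᶜ.IsClique {p | τ p = T} := by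
  rintro p rfl p' (hp' : τ p' = τ p) hne
  refine (SimpleGraph.compl_adj _ _ _).2 ⟨hne, ?_⟩
  -- An edge or a path of length 2 can change V, X or both. When V is kept, or changed after or
  -- before X, one of the two users is contained in the subfile of the other vertex; otherwise X is
  -- kept.
  rintro ⟨-, ⟨-, h | h⟩ | ⟨r, ⟨-, h | h⟩, -, h' | h'⟩⟩
  · exact hne (hτ.eq_of_user_le hp'.symm (h ▸ p'.2))
  · exact hne (hτ.eq_of_subfile_eq hp'.symm h)
  · exact hne (hτ.eq_of_user_le hp'.symm ((h.trans h') ▸ p'.2))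
  · refine hne (hτ.eq_of_user_le hp'.symm ?_)
    rw [h, ← h']
    exact r.2
  · refine hne (hτ.eq_of_user_le hp' ?_).symm
    rw [h, ← h']
    exact r.2
  · exact hne (hτ.eq_of_subfile_eq hp'.symm (h.trans h'))

/-- A vertex labelled T is determined by its X, and every X ⊇ T occurs, so the fibre is counted by
the subspaces above T. -/
theorem card_fiber [Fintype 𝔽] (hτ : IsMatchingLabel τ) (hk : m + t ≤ k) (T : Subspaces 𝔽 k m) :
    {p | τ p = T}.ncard = Nat.card (Subspaces 𝔽 (k - m) t) := by
  have h := card_ge_finrank_eq T.1 (r := t) (s := m + t) (n := k) (by rw [T.2])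
    (Module.finrank_fin_fun 𝔽) hk
  rw [T.2, ← card_subspaces (by omega), Nat.cast_inj] at h
  rw [← h, ← Nat.card_coe_set_eq]
  refine Nat.card_eq_of_bijective (fun p => ⟨p.1.subfile.1,
    (congrArg Subtype.val p.2).symm.trans_le (hτ.le_subfile p.1), p.1.subfile.2⟩) ⟨fun p p' h => ?_, fun X => ?_⟩
  · exact Subtype.ext (hτ.eq_of_subfile_eq (p.2.trans p'.2.symm)
      (Subtype.ext (Subtype.mk.inj h)))
  · obtain ⟨p, ⟨hp, hT⟩, -⟩ := hτ.bijective ⟨X.1, X.2.2⟩ T X.2.1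
    have hX : p.subfile.1 = X.1 := Subtype.ext_iff.1 hp
    exact ⟨⟨p, hT⟩, Subtype.ext hX⟩

end IsMatchingLabel

/-! ### The caching line graph and its two clique covers. -/

theorem isCachingLineGraph_projGraph [Fintype 𝔽] (hk : m + t ≤ k) :
    IsCachingLineGraph (projGraph 𝔽 k m t) ProjVertex.user (Nat.card (Subspaces 𝔽 (k - t) m)) where
  finite_vertices := inferInstance
  finite_users := inferInstance
  userClique_isClique _ _ hp _ hp' hne := ⟨hne, Or.inl (hp.trans hp'.symm)⟩
  userClique_card := card_user_fiber hk
  at_most_one e f g hfg hfe hf hg := by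
    have hf' := hf.2.resolve_left fun h => hfe h.symm
    have hg' := hg.2.resolve_left fun h => hfe (hfg.trans h.symm)
    exact projVertex_ext hfg (hf'.symm.trans hg')
  subfileClique_isClique e := by
    rw [subfileClique_projGraph]
    exact fun p hp p' hp' hne => ⟨hne, Or.inr (hp.trans hp'.symm)⟩

theorem card_subspaces_pos [Fintype 𝔽] {r : ℕ} (hr : r ≤ k) : 0 < Nat.card (Subspaces 𝔽 k r) := by
  have h := gaussBinom_pos (Fintype.one_lt_card (α := 𝔽)) hr
  rw [← card_subspaces (𝔽 := 𝔽) hr] at h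
  exact_mod_cast h

theorem IsMatchingLabel.isDisjointCliqueCover [Fintype 𝔽]
    {τ : ProjVertex 𝔽 k m t → Subspaces 𝔽 k m} (hτ : IsMatchingLabel τ) (hk : m + t ≤ k) :
    IsDisjointCliqueCover (square (projGraph 𝔽 k m t))ᶜ (labelCliques τ)
      (Nat.card (Subspaces 𝔽 (k - m) t)) where
  isClique := by
    rintro _ ⟨T, rfl⟩
    exact hτ.isClique T
  card_eq := by
    rintro _ ⟨T, rfl⟩
    exact hτ.card_fiber hk T
  disjoint := by
    rintro _ ⟨T, rfl⟩ _ ⟨T', rfl⟩ hne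
    refine Set.disjoint_left.2 fun p hp hp' => hne ?_
    have h : T = T' := (show τ p = T from hp).symm.trans hp'
    rw [h]
  cover := Set.eq_univ_of_forall fun p => ⟨_, ⟨τ p, rfl⟩, rfl⟩

theorem isDisjointCliqueCover_subfile [Fintype 𝔽] :
    IsDisjointCliqueCover (projGraph 𝔽 k m t)
      (Set.range (subfileClique (projGraph 𝔽 k m t) ProjVertex.user))
      (Nat.card (Subspaces 𝔽 (m + t) t)) where
  isClique := by
    rintro _ ⟨e, rfl⟩ p hp p' hp' hne
    rw [subfileClique_projGraph] at hp hp'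
    exact ⟨hne, Or.inr (hp.trans hp'.symm)⟩
  card_eq := by
    rintro _ ⟨e, rfl⟩
    rw [subfileClique_projGraph]
    exact card_subfile_fiber e.subfile
  disjoint := by
    rintro _ ⟨e, rfl⟩ _ ⟨e', rfl⟩ hne
    refine Set.disjoint_left.2 fun p hp hp' => hne ?_
    simp only [subfileClique_projGraph] at hp hp' ⊢
    have h : e.subfile = e'.subfile := (show p.subfile = e.subfile from hp).symm.trans hp'
    rw [h]
  cover := Set.eq_univ_of_forall fun p => ⟨_, ⟨p, rfl⟩, Set.mem_insert _ _⟩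

theorem isCDCachingLineGraph_projGraph [Fintype 𝔽] (hk : m + t ≤ k) :
    IsCDCachingLineGraph (projGraph 𝔽 k m t) ProjVertex.user (Nat.card (Subspaces 𝔽 (k - t) m))
      (Nat.card (Subspaces 𝔽 (m + t) t)) (Nat.card (Subspaces 𝔽 (k - m) t)) where
  isCachingLineGraph := isCachingLineGraph_projGraph hk
  c_pos := card_subspaces_pos (by omega)
  d_pos := card_subspaces_pos (by omega)
  subfile_cover := ⟨Set.range (subfileClique (projGraph 𝔽 k m t) ProjVertex.user),
    fun _ ⟨e, he⟩ => ⟨e, he.symm⟩, isDisjointCliqueCover_subfile⟩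
  transmission_cover := by
    obtain ⟨τ, hτ⟩ := exists_isMatchingLabel 𝔽 k m t
    exact ⟨_, hτ.isDisjointCliqueCover hk⟩

/-- No C_T is empty, so T can be read off from C_T, and transmissions can be counted by the
subspaces T. -/
theorem IsMatchingLabel.card_labelCliques [Fintype 𝔽]
    {τ : ProjVertex 𝔽 k m t → Subspaces 𝔽 k m} (hτ : IsMatchingLabel τ) (hk : m + t ≤ k) :
    Nat.card (labelCliques τ) = Nat.card (Subspaces 𝔽 k m) := by
  refine Nat.card_range_of_injective fun T T' h => ?_
  have hpos := card_subspaces_pos (𝔽 := 𝔽) (k := k - m) (r := t) (by omega)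
  rw [← hτ.card_fiber hk T] at hpos
  obtain ⟨p, hp⟩ := (Set.ncard_pos (Set.toFinite _)).1 hpos
  exact (show τ p = T from hp).symm.trans ((Set.ext_iff.1 h p).1 hp)

/-! ### Delivery and decoding. -/

section Scheme

variable {A : Type*} [AddCommGroup A] {N : ℕ}

theorem cliqueTransmission_eq [Finite 𝔽] {p : ProjVertex 𝔽 k m t} {C : Set (ProjVertex 𝔽 k m t)}
    (hp : p ∈ C) (dem : Subspaces 𝔽 k t → Fin N) (file : Fin N → Subspaces 𝔽 k (m + t) → A) :
    cliqueTransmission ProjVertex.user ProjVertex.subfile C dem file =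
      file (dem p.user) p.subfile +
        cliqueTransmission ProjVertex.user ProjVertex.subfile (C \ {p}) dem file := by
  unfold cliqueTransmission
  rw [← finsum_mem_insert (fun e : ProjVertex 𝔽 k m t => file (dem e.user) e.subfile)
    (fun h : p ∈ C \ {p} => h.2 rfl) (Set.toFinite _), Set.insert_sdiff_singleton,
    Set.insert_eq_of_mem hp]

open Classical in
/-- The coded caching scheme of a choice of matching subspaces. A user subtracts from the
transmission that contains a missing subfile the other summands, which it has in its cache. -/
def IsMatchingLabel.scheme [Finite 𝔽] {τ : ProjVertex 𝔽 k m t → Subspaces 𝔽 k m}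
    (hτ : IsMatchingLabel τ) (A : Type*) [AddCommGroup A] (N : ℕ) :
    Scheme A (Subspaces 𝔽 k t) (Subspaces 𝔽 k (m + t)) (labelCliques τ) N where
  cached := projCached 𝔽 k m t
  transmit dem file C := cliqueTransmission ProjVertex.user ProjVertex.subfile C.1 dem file
  decode V dem cache sent X :=
    if h : V.1 ≤ X.1 then
      sent ⟨{p | τ p = τ ⟨(V, X), h⟩}, _, rfl⟩ -
        cliqueTransmission ProjVertex.user ProjVertex.subfile
          ({p | τ p = τ ⟨(V, X), h⟩} \ {⟨(V, X), h⟩}) dem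
          -- The value 0 only makes the function total: every Y that occurs in this sum is cached by
          -- V.
          fun i Y => if hY : Y ∈ projCached 𝔽 k m t V then cache i ⟨Y, hY⟩ else 0
    else cache (dem V) ⟨X, h⟩
  decode_eq dem file V := by
    funext X
    split_ifs with h
    · refine sub_eq_iff_eq_add.2 ((cliqueTransmission_eq (p := ⟨(V, X), h⟩)
        (C := {p | τ p = τ ⟨(V, X), h⟩}) rfl dem file).trans ?_)
      refine congrArg (file (dem V) X + ·) (finsum_mem_congr rfl fun p hp => ?_)
      have hp' : p.subfile ∈ projCached 𝔽 k m t V := fun hle =>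
        hp.2 (hτ.eq_of_user_le (p := ⟨(V, X), h⟩) (Eq.symm hp.1) hle).symm
      simp [hp']
    · rfl

/-- The subfiles that V lacks are those containing V, which correspond to the vertices of its
user-clique. -/
theorem ncard_cached [Fintype 𝔽] (hk : m + t ≤ k) (V : Subspaces 𝔽 k t) :
    (projCached 𝔽 k m t V).ncard + Nat.card (Subspaces 𝔽 (k - t) m) =
      Nat.card (Subspaces 𝔽 k (m + t)) := by
  rw [← card_user_fiber hk V, ← Set.ncard_add_ncard_compl (projCached 𝔽 k m t V)]
  congr 1
  refine Set.ncard_congr (fun p _ => p.subfile) ?_ ?_ ?_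
  · rintro p rfl
    exact not_not.2 p.2
  · intro p p' hp hp' h
    exact projVertex_ext (Eq.trans hp (Eq.symm hp')) h
  · intro X hX
    exact ⟨⟨(V, X), not_not.1 hX⟩, rfl, rfl⟩

end Scheme

/-! ### Cache size and rate by double counting the vertices. -/

theorem card_mul_card_user_fiber [Fintype 𝔽] (hk : m + t ≤ k) :
    Nat.card (Subspaces 𝔽 k t) * Nat.card (Subspaces 𝔽 (k - t) m) =
      Nat.card (Subspaces 𝔽 k (m + t)) * Nat.card (Subspaces 𝔽 (m + t) t) := by
  rw [← card_eq_card_mul_of_fiber (ProjVertex.user (𝔽 := 𝔽) (m := m)) (card_user_fiber hk),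
    ← card_eq_card_mul_of_fiber (ProjVertex.subfile (𝔽 := 𝔽) (k := k)) card_subfile_fiber]

theorem IsMatchingLabel.card_mul_card_fiber [Fintype 𝔽]
    {τ : ProjVertex 𝔽 k m t → Subspaces 𝔽 k m} (hτ : IsMatchingLabel τ) (hk : m + t ≤ k) :
    Nat.card (Subspaces 𝔽 k m) * Nat.card (Subspaces 𝔽 (k - m) t) =
      Nat.card (Subspaces 𝔽 k (m + t)) * Nat.card (Subspaces 𝔽 (m + t) t) := by
  rw [← card_eq_card_mul_of_fiber τ (hτ.card_fiber hk),
    ← card_eq_card_mul_of_fiber (ProjVertex.subfile (𝔽 := 𝔽) (k := k)) card_subfile_fiber]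

theorem IsMatchingLabel.hasCacheSize_scheme [Fintype 𝔽]
    {τ : ProjVertex 𝔽 k m t → Subspaces 𝔽 k m} (hτ : IsMatchingLabel τ) (hk : m + t ≤ k)
    (A : Type*) [AddCommGroup A] (N : ℕ) :
    (hτ.scheme A N).HasCacheSize
      (N * (1 - Nat.card (Subspaces 𝔽 (m + t) t) / Nat.card (Subspaces 𝔽 k t))) := by
  intro V
  have hprod : ({p | p.2 ∈ (hτ.scheme A N).cached V} :
      Set (Fin N × Subspaces 𝔽 k (m + t))).ncard = N * (projCached 𝔽 k m t V).ncard := by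
    have h := Set.ncard_prod (s := (Set.univ : Set (Fin N))) (t := projCached 𝔽 k m t V)
    rwa [Set.ncard_univ, Nat.card_eq_fintype_card, Fintype.card_fin, Set.univ_prod] at h
  have hc : ((projCached 𝔽 k m t V).ncard : ℚ) + Nat.card (Subspaces 𝔽 (k - t) m) =
      Nat.card (Subspaces 𝔽 k (m + t)) := by exact_mod_cast ncard_cached hk V
  have hd : (Nat.card (Subspaces 𝔽 k t) : ℚ) * Nat.card (Subspaces 𝔽 (k - t) m) =
      Nat.card (Subspaces 𝔽 k (m + t)) * Nat.card (Subspaces 𝔽 (m + t) t) := by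
    exact_mod_cast card_mul_card_user_fiber hk
  have hK : (Nat.card (Subspaces 𝔽 k t) : ℚ) ≠ 0 := by
    exact_mod_cast (card_subspaces_pos (by omega)).ne'
  rw [hprod, Nat.cast_mul, eq_sub_of_add_eq hc, Scheme.subpacketization]
  field_simp
  linear_combination (-N : ℚ) * hd

theorem IsMatchingLabel.rate_scheme [Fintype 𝔽]
    {τ : ProjVertex 𝔽 k m t → Subspaces 𝔽 k m} (hτ : IsMatchingLabel τ) (hk : m + t ≤ k)
    (A : Type*) [AddCommGroup A] (N : ℕ) :
    (hτ.scheme A N).rate =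
      Nat.card (Subspaces 𝔽 (m + t) t) / Nat.card (Subspaces 𝔽 (k - m) t) := by
  have hF : (Nat.card (Subspaces 𝔽 k (m + t)) : ℚ) ≠ 0 := by
    exact_mod_cast (card_subspaces_pos hk).ne'
  have hd : (Nat.card (Subspaces 𝔽 (k - m) t) : ℚ) ≠ 0 := by
    exact_mod_cast (card_subspaces_pos (by omega)).ne'
  rw [Scheme.rate, hτ.card_labelCliques hk, Scheme.subpacketization, div_eq_div_iff hF hd, mul_comm
    (Nat.card (Subspaces 𝔽 (m + t) t) : ℚ)]
  exact_mod_cast hτ.card_mul_card_fiber hk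

end CodedCaching

end

theorem theorem3 {𝔽 : Type*} [Field 𝔽] [Fintype 𝔽] (k m t : ℕ) (hm : 0 < m) (ht : 0 < t)
    (hk : m + t ≤ k) :
    -- the constructed graph is a caching line graph with the stated parameters
    (∃ D c d : ℕ,
      (D : ℚ) = CodedCaching.gaussBinom (Fintype.card 𝔽) (k - t) m ∧
      (c : ℚ) = CodedCaching.gaussBinom (Fintype.card 𝔽) (m + t) t ∧
      (d : ℚ) = CodedCaching.gaussBinom (Fintype.card 𝔽) (k - m) t ∧
      CodedCaching.IsCDCachingLineGraph (CodedCaching.projGraph 𝔽 k m t)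
        CodedCaching.ProjVertex.user D c d) ∧
    -- its subfile-cliques are the sets of all pairs with a common second entry
    (∀ p : CodedCaching.ProjVertex 𝔽 k m t,
      CodedCaching.subfileClique (CodedCaching.projGraph 𝔽 k m t)
        CodedCaching.ProjVertex.user p = {p' | p'.subfile = p.subfile}) ∧
    -- it is the line graph of the bipartite graph of the caching rule
    (∃ φ : CodedCaching.projGraph 𝔽 k m t ≃g
        (CodedCaching.uncachedGraph (CodedCaching.projCached 𝔽 k m t)).lineGraph,
      ∀ p, (φ p : Sym2 (CodedCaching.Subspaces 𝔽 k t ⊕ CodedCaching.Subspaces 𝔽 k (m + t))) =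
        s(Sum.inl p.user, Sum.inr p.subfile)) ∧
    -- matching subspaces exist
    (∃ τ : CodedCaching.ProjVertex 𝔽 k m t → CodedCaching.Subspaces 𝔽 k m,
      CodedCaching.IsMatchingLabel τ) ∧
    -- every choice of them gives a clique cover and a coded caching scheme
    (∀ τ : CodedCaching.ProjVertex 𝔽 k m t → CodedCaching.Subspaces 𝔽 k m,
      CodedCaching.IsMatchingLabel τ →
      (∃ d : ℕ, (d : ℚ) = CodedCaching.gaussBinom (Fintype.card 𝔽) (k - m) t ∧
        CodedCaching.IsDisjointCliqueCover
          (CodedCaching.square (CodedCaching.projGraph 𝔽 k m t))ᶜ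
          (CodedCaching.labelCliques τ) d) ∧
      ∀ (A : Type*) [AddCommGroup A] [Finite A] (N : ℕ), 0 < N →
        ∃ S : CodedCaching.Scheme A (CodedCaching.Subspaces 𝔽 k t)
            (CodedCaching.Subspaces 𝔽 k (m + t)) (CodedCaching.labelCliques τ) N,
          S.cached = CodedCaching.projCached 𝔽 k m t ∧
          (∀ dem file C, S.transmit dem file C =
            CodedCaching.cliqueTransmission CodedCaching.ProjVertex.user
              CodedCaching.ProjVertex.subfile C.1 dem file) ∧
          (S.numUsers : ℚ) = CodedCaching.gaussBinom (Fintype.card 𝔽) k t ∧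
          (S.subpacketization : ℚ) = CodedCaching.gaussBinom (Fintype.card 𝔽) k (m + t) ∧
          (∃ M : ℚ, S.HasCacheSize M ∧
            M / N = 1 - CodedCaching.gaussBinom (Fintype.card 𝔽) (m + t) t /
              CodedCaching.gaussBinom (Fintype.card 𝔽) k t) ∧
          S.rate = CodedCaching.gaussBinom (Fintype.card 𝔽) (m + t) t /
            CodedCaching.gaussBinom (Fintype.card 𝔽) (k - m) t) := by
  have hD := CodedCaching.card_subspaces (𝔽 := 𝔽) (show m ≤ k - t by omega)
  have hc := CodedCaching.card_subspaces (𝔽 := 𝔽) (show t ≤ m + t by omega)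
  have hd := CodedCaching.card_subspaces (𝔽 := 𝔽) (show t ≤ k - m by omega)
  refine ⟨⟨_, _, _, hD, hc, hd, CodedCaching.isCDCachingLineGraph_projGraph hk⟩,
    CodedCaching.subfileClique_projGraph, ⟨CodedCaching.projGraphIso 𝔽 k m t, fun _ => rfl⟩,
    CodedCaching.exists_isMatchingLabel 𝔽 k m t, fun τ hτ =>
    ⟨⟨_, hd, hτ.isDisjointCliqueCover hk⟩, fun A _ _ N hN => ⟨hτ.scheme A N, rfl, fun _ _ _ => rfl,
      CodedCaching.card_subspaces (by omega), CodedCaching.card_subspaces hk,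
      ⟨_, hτ.hasCacheSize_scheme hk A N, ?_⟩, ?_⟩⟩⟩
  -- Here M is N·(1 − c/K), and N > 0 permits the division.
  · rw [← hc, ← CodedCaching.card_subspaces (show t ≤ k by omega), mul_div_cancel_left₀]
    exact_mod_cast hN.ne'
  · rw [hτ.rate_scheme hk, hc, hd]
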